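/- For an integer $N\ge 0$ let $$\zeta(3,\{2\}^N)=\sum_{n_1>n_2>\cdots>n_{N+1}\ge 1}\frac{1}{n_1^{3}\,n_2^{2}\cdots n_{N+1}^{2}},\qquad t(3,\{2\}^N)=\sum_{\substack{n_1>n_2>\cdots>n_{N+1}\ge 1\\ n_j\ \mathrm{odd}}}\frac{1}{n_1^{3}\,n_2^{2}\cdots n_{N+1}^{2}},$$ where the $n_j$ are integers, and let $\mathbf{Q}[\pi,\zeta(3),\zeta(5),\dots,\zeta(2N+3)]_{2N+3}$ denote the set of all numbers $P(\pi,\zeta(3),\zeta(5),\dots,\zeta(2N+3))$, where $P\in\mathbf{Q}[x_0,x_1,\dots,x_{N+1}]$ is homogeneous of weighted degree $2N+3$ for the grading $\deg x_0=1$ and $\deg x_j=2j+1$ for $1\le j\le N+1$ (so that $\pi$ has degree $1$ and $\zeta(2j+1)$ has degree $2j+1$); here $\zeta(s)$ is the Riemann zeta function. Then, for every integer $N\ge 0$, both series converge and $$\zeta(3,\{2\}^N)\in\mathbf{Q}[\pi,\zeta(3),\zeta(5),\dots,\zeta(2N+3)]_{2N+3}\quad\text{and}\quad t(3,\{2\}^N)\in\mathbf{Q}[\pi,\zeta(3),\zeta(5),\dots,\zeta(2N+3)]_{2N+3}.$$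 -/

import Mathlib

namespace MultipleZeta

/-- Strictly decreasing `k`-tuples `n₁ > n₂ > ⋯ > n_k ≥ 1` of positive integers. -/
def Decreasing (k : ℕ) : Set (Fin k → ℕ) :=
  {n | StrictAnti n ∧ ∀ j, 1 ≤ n j}

/-- Strictly decreasing `k`-tuples `n₁ > n₂ > ⋯ > n_k ≥ 1` of odd positive integers. -/
def DecreasingOdd (k : ℕ) : Set (Fin k → ℕ) :=
  {n | StrictAnti n ∧ ∀ j, 1 ≤ n j ∧ Odd (n j)}

/-- The term `1 / (n₁ ^ i₁ * ⋯ * n_k ^ i_k)`. -/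
noncomputable def term {k : ℕ} (i n : Fin k → ℕ) : ℝ :=
  1 / ∏ j, (n j : ℝ) ^ i j

/-- The multiple zeta value `ζ(i₁, …, i_k)`. -/
noncomputable def mzv {k : ℕ} (i : Fin k → ℕ) : ℝ :=
  ∑' n : Decreasing k, term i n

/-- The multiple `t`-value `t(i₁, …, i_k)`. -/
noncomputable def mtv {k : ℕ} (i : Fin k → ℕ) : ℝ :=
  ∑' n : DecreasingOdd k, term i n

/-- The index `(3, 2, …, 2)` with `N` entries equal to `2`. -/
def index322 (N : ℕ) : Fin (N + 1) → ℕ :=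
  Fin.cons 3 (fun _ => 2)

/-- The numbers `π, ζ(3), ζ(5), …, ζ(2N+3)`. -/
noncomputable def generator (N : ℕ) : Fin (N + 2) → ℂ :=
  Fin.cons (Real.pi : ℂ) (fun j : Fin (N + 1) => riemannZeta ((2 * (j : ℕ) + 3 : ℕ) : ℂ))

/-- The degrees `1, 3, 5, …, 2N+3` of the variables that stand for
`π, ζ(3), ζ(5), …, ζ(2N+3)`. -/
def degree (N : ℕ) : Fin (N + 2) → ℕ :=
  Fin.cons 1 (fun j : Fin (N + 1) => 2 * (j : ℕ) + 3)

/-- `ℚ[π, ζ(3), ζ(5), …, ζ(2N+3)]_d`: the values at `π, ζ(3), …, ζ(2N+3)` of the rational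
polynomials that are homogeneous of degree `d` for the grading `degree N`. -/
noncomputable def gradedPart (N d : ℕ) : Submodule ℚ ℂ :=
  (MvPolynomial.weightedHomogeneousSubmodule ℚ (degree N) d).map
    (MvPolynomial.aeval (generator N) : MvPolynomial (Fin (N + 2)) ℚ →ₐ[ℚ] ℂ).toLinearMap

end MultipleZeta

open Filter Topology Finset intervalIntegral
open scoped Real Nat

namespace MultipleZeta

/-! Take p = 1 for the t-value and p = 2 for the zeta value, and put j = 2N + p. In powers of sin θ,
the coefficients of θ^j / j! are nested sums of 1/(2l+p)^2 over Wallis integrals. Integrating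
against (π/2 - x) cot x cancels the Wallis integrals, so the series of nested sums over (2i+p)^3
becomes, up to the factor `wallisConst p`, the integral of (π/2 - x) x^j cot x / j! over [0, π/2]
(`hasSum_nestedSum_div`).

The regularised expansion cot x = 2 ∑ sin 2nx, justified by the Riemann-Lebesgue lemma, turns this
integral into sums of moments of sin 2nx (`integral_sinQuotient_mul_cos_eq`). Integration by parts
lowers the moment by two (`sinRemainder_add_two`), ending in odd zeta values, plain or alternating,
times powers of π. Even moments m give weight m + 1; odd ones give π times weight m. For p = 2 the
whole integral is therefore divisible by π, and `wallisConst 2` = π/2 removes that factor. -/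

/-! ### Wallis integrals. -/

/-- The Wallis integral of `sin ^ n` over a quarter period. -/
noncomputable def wallis (n : ℕ) : ℝ := ∫ x in (0 : ℝ)..(π / 2), Real.sin x ^ n

theorem wallis_add_two (n : ℕ) : (n + 2 : ℝ) * wallis (n + 2) = (n + 1) * wallis n := by
  have h : (n + 2 : ℝ) ≠ 0 := by positivity
  rw [wallis, integral_sin_pow, wallis]
  simp
  field_simp

theorem wallis_one : wallis 1 = 1 := by
  simp [wallis]

theorem wallis_two : wallis 2 = π / 4 := by
  have h := wallis_add_two 0
  simp [wallis] at h ⊢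
  linarith

theorem wallis_pos (n : ℕ) : 0 < wallis n := by
  refine intervalIntegral_pos_of_pos_on (Continuous.intervalIntegrable (by fun_prop) _ _) ?_
    (by positivity)
  intro x hx
  have := Real.sin_pos_of_pos_of_lt_pi hx.1 (by linarith [hx.2, Real.pi_pos])
  positivity

/-- By the recurrence, n * `wallis n` does not decrease when n grows by two. Hence 1 / `wallis n`
grows at most linearly, which any geometric decay beats. -/
theorem wallis_lower_bound (p i : ℕ) :
    p * wallis p ≤ ((2 * i + p : ℕ) : ℝ) * wallis (2 * i + p) := by
  induction i with
  | zero => simp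
  | succ i ih =>
    have h := wallis_add_two (2 * i + p)
    have e : 2 * (i + 1) + p = 2 * i + p + 2 := by ring
    rw [e]
    push_cast at *
    nlinarith [wallis_pos (2 * i + p)]

/-! ### Nested sums and the coefficients of powers of arcsin. -/

/-- The sum of `∏ 1 / (2 l + p) ^ 2` over strictly decreasing `k`-tuples of indices `l < i`. -/
noncomputable def nestedSum (p : ℕ) : ℕ → ℕ → ℝ
  | 0, _ => 1
  | k + 1, i => ∑ l ∈ range i, nestedSum p k l / ((2 * l + p : ℕ) : ℝ) ^ 2

theorem nestedSum_nonneg (p k i : ℕ) : 0 ≤ nestedSum p k i := by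
  induction k generalizing i with
  | zero => simp [nestedSum]
  | succ k ih => exact sum_nonneg fun l _ => div_nonneg (ih l) (by positivity)

theorem nestedSum_le {p : ℕ} (hp : 1 ≤ p) (k i : ℕ) : nestedSum p k i ≤ (i + 1 : ℝ) ^ k := by
  induction k generalizing i with
  | zero => simp [nestedSum]
  | succ k ih =>
    calc nestedSum p (k + 1) i ≤ ∑ l ∈ range i, (i + 1 : ℝ) ^ k := by
          refine sum_le_sum fun l hl => ?_
          have h1 : (1 : ℝ) ≤ ((2 * l + p : ℕ) : ℝ) ^ 2 := by
            apply one_le_pow₀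
            exact_mod_cast (by omega : 1 ≤ 2 * l + p)
          have h2 : (l : ℝ) ≤ i := by exact_mod_cast (mem_range.1 hl).le
          calc nestedSum p k l / ((2 * l + p : ℕ) : ℝ) ^ 2 ≤ nestedSum p k l :=
                div_le_self (nestedSum_nonneg _ _ _) h1
            _ ≤ (l + 1 : ℝ) ^ k := ih l
            _ ≤ _ := by gcongr
      _ = i * (i + 1 : ℝ) ^ k := by simp
      _ ≤ (i + 1 : ℝ) ^ (k + 1) := by
          rw [pow_succ']
          gcongr
          linarith

/-- The normalising constant in `arcsinCoeff`. -/
noncomputable def wallisConst (p : ℕ) : ℝ := (p : ℝ) ^ 2 * wallis p / p !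

/-- The coefficient of `y ^ (2 i + p)` in the power series of `arcsin y ^ (2 k + p) / (2 k + p)!`
for `p = 1, 2`. -/
noncomputable def arcsinCoeff (p k i : ℕ) : ℝ :=
  wallisConst p * nestedSum p k i / (((2 * i + p : ℕ) : ℝ) ^ 2 * wallis (2 * i + p))

theorem wallisConst_pos {p : ℕ} (hp : 1 ≤ p) : 0 < wallisConst p := by
  have := wallis_pos p
  have : 0 < (p : ℝ) := by exact_mod_cast hp
  unfold wallisConst
  positivity

theorem arcsinCoeff_nonneg {p : ℕ} (hp : 1 ≤ p) (k i : ℕ) : 0 ≤ arcsinCoeff p k i := by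
  have := wallis_pos (2 * i + p)
  have := nestedSum_nonneg p k i
  have := wallisConst_pos hp
  unfold arcsinCoeff
  positivity

theorem arcsinCoeff_zero_zero {p : ℕ} (hp : 1 ≤ p) : arcsinCoeff p 0 0 = 1 / p ! := by
  have := wallis_pos p
  have : 0 < (p : ℝ) := by exact_mod_cast hp
  simp only [arcsinCoeff, wallisConst, nestedSum, mul_zero, zero_add]
  field_simp

theorem arcsinCoeff_succ_zero (p k : ℕ) : arcsinCoeff p (k + 1) 0 = 0 := by
  simp [arcsinCoeff, nestedSum]

theorem sq_mul_arcsinCoeff {p : ℕ} (hp : 1 ≤ p) (k i : ℕ) :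
    ((2 * i + p : ℕ) : ℝ) ^ 2 * arcsinCoeff p k i
      = wallisConst p * nestedSum p k i / wallis (2 * i + p) := by
  have := wallis_pos (2 * i + p)
  have : 0 < ((2 * i + p : ℕ) : ℝ) := by exact_mod_cast (by omega : 0 < 2 * i + p)
  unfold arcsinCoeff
  field_simp

theorem mul_arcsinCoeff_succ (p k i : ℕ) :
    ((2 * i + p : ℕ) + 2 : ℝ) * ((2 * i + p : ℕ) + 1) * arcsinCoeff p k (i + 1)
      = wallisConst p * nestedSum p k (i + 1) / wallis (2 * i + p) := by
  have h0 := wallis_pos (2 * i + p)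
  have h2 := wallis_pos (2 * i + p + 2)
  have h := wallis_add_two (2 * i + p)
  have e : 2 * (i + 1) + p = 2 * i + p + 2 := by ring
  rw [arcsinCoeff, e]
  generalize 2 * i + p = n at *
  push_cast
  have : (0 : ℝ) < n + 2 := by positivity
  rw [mul_div_assoc', div_eq_div_iff (by positivity) (by positivity)]
  linear_combination (- ((n : ℝ) + 2) * (wallisConst p * nestedSum p k (i + 1))) * h

theorem arcsinCoeff_zero_recurrence {p : ℕ} (hp : 1 ≤ p) (i : ℕ) :
    ((2 * i + p : ℕ) + 2 : ℝ) * ((2 * i + p : ℕ) + 1) * arcsinCoeff p 0 (i + 1)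
      = ((2 * i + p : ℕ) : ℝ) ^ 2 * arcsinCoeff p 0 i := by
  rw [mul_arcsinCoeff_succ, sq_mul_arcsinCoeff hp]
  simp [nestedSum]

/-- Coefficient form of the fact that θ^(2k+2+p)/(2k+2+p)! has second derivative θ^(2k+p)/(2k+p)!.
The extra term on the right is the last summand of the nested sum. -/
theorem arcsinCoeff_succ_recurrence {p : ℕ} (hp : 1 ≤ p) (k i : ℕ) :
    ((2 * i + p : ℕ) + 2 : ℝ) * ((2 * i + p : ℕ) + 1) * arcsinCoeff p (k + 1) (i + 1)
      = ((2 * i + p : ℕ) : ℝ) ^ 2 * arcsinCoeff p (k + 1) i + arcsinCoeff p k i := by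
  rw [mul_arcsinCoeff_succ, sq_mul_arcsinCoeff hp, arcsinCoeff]
  have := wallis_pos (2 * i + p)
  have : 0 < ((2 * i + p : ℕ) : ℝ) := by exact_mod_cast (by omega : 0 < 2 * i + p)
  simp only [nestedSum, sum_range_succ]
  field_simp

theorem tendsto_sq_mul_arcsinCoeff_mul_pow {p : ℕ} (hp : 1 ≤ p) (hp2 : p ≤ 2) (k : ℕ) {r : ℝ}
    (h0 : 0 ≤ r) (h1 : r < 1) :
    Tendsto (fun i : ℕ => ((2 * i + p : ℕ) : ℝ) ^ 2 * arcsinCoeff p k i * r ^ (2 * i + p))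
      atTop (𝓝 0) := by
  have hp' : 0 < (p : ℝ) := by exact_mod_cast hp
  have hK := wallisConst_pos hp
  have hW := wallis_pos p
  have lim := ((tendsto_pow_const_mul_const_pow_of_abs_lt_one (k + 1)
    (abs_lt.2 ⟨by linarith, h1⟩)).comp (tendsto_add_atTop_nat 1)).const_mul
    (wallisConst p * 2 / (p * wallis p))
  rw [mul_zero] at lim
  refine squeeze_zero (fun i => ?_) (fun i => ?_) lim
  · have := arcsinCoeff_nonneg hp k i
    positivity
  · rw [sq_mul_arcsinCoeff hp]
    have hn : (0 : ℝ) < (2 * i + p : ℕ) := by exact_mod_cast (by omega : 0 < 2 * i + p)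
    have hn2 : ((2 * i + p : ℕ) : ℝ) ≤ 2 * (i + 1) := by
      exact_mod_cast (by omega : 2 * i + p ≤ 2 * (i + 1))
    have hw := wallis_pos (2 * i + p)
    have b1 : 1 / wallis (2 * i + p) ≤ 2 * (i + 1) / (p * wallis p) := by
      rw [div_le_div_iff₀ hw (by positivity)]
      have := wallis_lower_bound p i
      nlinarith
    have b2 : r ^ (2 * i + p) ≤ r ^ (i + 1) := pow_le_pow_of_le_one h0 h1.le (by omega)
    calc wallisConst p * nestedSum p k i / wallis (2 * i + p) * r ^ (2 * i + p)
        = wallisConst p * nestedSum p k i * (1 / wallis (2 * i + p)) * r ^ (2 * i + p) := by ring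
      _ ≤ wallisConst p * (i + 1) ^ k * (2 * (i + 1) / (p * wallis p)) * r ^ (i + 1) := by
          gcongr
          exact nestedSum_le hp k i
      _ = _ := by
          simp only [Function.comp_apply]
          push_cast
          ring

/-! ### Convergence of the expansion in powers of sin θ. -/

/-- Partial sums of the expansion of `θ ^ (2 k + p) / (2 k + p)!` in powers of `sin θ`. -/
noncomputable def arcsinPartial (p k M : ℕ) (x : ℝ) : ℝ :=
  ∑ i ∈ range M, arcsinCoeff p k i * Real.sin x ^ (2 * i + p)

theorem hasDerivAt_sin_pow (n : ℕ) (x : ℝ) :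
    HasDerivAt (fun x => Real.sin x ^ n) (n * Real.sin x ^ (n - 1) * Real.cos x) x :=
  (Real.hasDerivAt_sin x).pow n

theorem hasDerivAt_sin_pow_mul_cos (n : ℕ) (x : ℝ) :
    HasDerivAt (fun x => n * Real.sin x ^ (n - 1) * Real.cos x)
      (n * (n - 1) * Real.sin x ^ (n - 2) - n ^ 2 * Real.sin x ^ n) x := by
  have h := ((hasDerivAt_sin_pow (n - 1) x).const_mul (n : ℝ)).mul (Real.hasDerivAt_cos x)
  refine h.congr_deriv ?_
  rcases n with _ | _ | n
  · simp
  · simp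
  · have := Real.sin_sq_add_cos_sq x
    simp only [Nat.add_sub_cancel, show n + 1 + 1 - 2 = n by omega, show n + 1 - 1 = n by omega]
    push_cast
    linear_combination ((n + 2 : ℝ) * (n + 1) * Real.sin x ^ n) * this

/-- The derivative of `arcsinPartial`. -/
noncomputable def arcsinPartialDeriv (p k M : ℕ) (x : ℝ) : ℝ :=
  ∑ i ∈ range M, arcsinCoeff p k i *
    ((2 * i + p : ℕ) * Real.sin x ^ (2 * i + p - 1) * Real.cos x)

/-- The second derivative of `arcsinPartial`. -/
noncomputable def arcsinPartialDeriv₂ (p k M : ℕ) (x : ℝ) : ℝ :=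
  ∑ i ∈ range M, arcsinCoeff p k i *
    ((2 * i + p : ℕ) * ((2 * i + p : ℕ) - 1) * Real.sin x ^ (2 * i + p - 2)
      - ((2 * i + p : ℕ) : ℝ) ^ 2 * Real.sin x ^ (2 * i + p))

theorem hasDerivAt_arcsinPartial (p k M : ℕ) (x : ℝ) :
    HasDerivAt (arcsinPartial p k M) (arcsinPartialDeriv p k M x) x :=
  HasDerivAt.fun_sum fun _ _ => (hasDerivAt_sin_pow _ x).const_mul _

theorem hasDerivAt_arcsinPartialDeriv (p k M : ℕ) (x : ℝ) :
    HasDerivAt (arcsinPartialDeriv p k M) (arcsinPartialDeriv₂ p k M x) x :=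
  HasDerivAt.fun_sum fun _ _ => (hasDerivAt_sin_pow_mul_cos _ x).const_mul _

/-- The recurrence telescopes the sum to its top term; p - 1 is the second derivative of θ^p / p!
for p = 1, 2. -/
theorem arcsinPartialDeriv₂_zero {p : ℕ} (hp : 1 ≤ p) (hp2 : p ≤ 2) (M : ℕ) (x : ℝ) :
    arcsinPartialDeriv₂ p 0 (M + 1) x
      = (p - 1) - ((2 * M + p : ℕ) : ℝ) ^ 2 * arcsinCoeff p 0 M * Real.sin x ^ (2 * M + p) := by
  induction M with
  | zero =>
    simp only [arcsinPartialDeriv₂, zero_add, range_one, sum_singleton, arcsinCoeff_zero_zero hp]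
    interval_cases p <;> norm_num [Nat.factorial]; ring
  | succ M ih =>
    rw [arcsinPartialDeriv₂, sum_range_succ, ← arcsinPartialDeriv₂, ih]
    have h := arcsinCoeff_zero_recurrence hp M
    have e : 2 * (M + 1) + p = 2 * M + p + 2 := by ring
    rw [e]
    generalize 2 * M + p = n at *
    simp only [Nat.add_sub_cancel]
    push_cast
    linear_combination (Real.sin x ^ n) * h

/-- The same telescoping. One term is lost on the right because the coefficient of index 0 vanishes
at level k + 1. -/
theorem arcsinPartialDeriv₂_succ {p : ℕ} (hp : 1 ≤ p) (k M : ℕ) (x : ℝ) :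
    arcsinPartialDeriv₂ p (k + 1) (M + 1) x = arcsinPartial p k M x
      - ((2 * M + p : ℕ) : ℝ) ^ 2 * arcsinCoeff p (k + 1) M * Real.sin x ^ (2 * M + p) := by
  induction M with
  | zero => simp [arcsinPartialDeriv₂, arcsinPartial, arcsinCoeff_succ_zero]
  | succ M ih =>
    rw [arcsinPartialDeriv₂, sum_range_succ, ← arcsinPartialDeriv₂, ih, arcsinPartial,
      arcsinPartial, sum_range_succ]
    have h := arcsinCoeff_succ_recurrence hp k M
    have e : 2 * (M + 1) + p = 2 * M + p + 2 := by ring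
    rw [e]
    generalize 2 * M + p = n at *
    simp only [Nat.add_sub_cancel]
    push_cast
    linear_combination (Real.sin x ^ n) * h

theorem arcsinPartial_apply_zero {p : ℕ} (hp : 1 ≤ p) (k M : ℕ) : arcsinPartial p k M 0 = 0 :=
  sum_eq_zero fun i _ => by simp [zero_pow (show 2 * i + p ≠ 0 by omega)]

theorem arcsinPartialDeriv_apply_zero {p : ℕ} (hp : 1 ≤ p) (hp2 : p ≤ 2) (k M : ℕ) :
    arcsinPartialDeriv p k (M + 1) 0 = (0 : ℝ) ^ (2 * k + p - 1) / (2 * k + p - 1)! := by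
  rw [arcsinPartialDeriv, sum_range_succ', sum_eq_zero, zero_add]
  · rcases k with _ | k
    · rw [arcsinCoeff_zero_zero hp]
      interval_cases p <;> simp
    · simp [arcsinCoeff_succ_zero, show 2 * (k + 1) + p - 1 ≠ 0 by omega]
  · intro i _
    simp [show 2 * (i + 1) + p - 1 ≠ 0 by omega]

theorem abs_le_of_abs_deriv_le {f f' : ℝ → ℝ} {a ε : ℝ} (h0 : f 0 = 0)
    (hf : ∀ x, HasDerivAt f (f' x) x) (hb : ∀ x ∈ Set.Icc 0 a, |f' x| ≤ ε) :
    ∀ x ∈ Set.Icc 0 a, |f x| ≤ ε * a := by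
  intro x hx
  have h := (convex_Icc (0 : ℝ) a).norm_image_sub_le_of_norm_hasDerivWithin_le
    (fun y _ => (hf y).hasDerivWithinAt) hb (⟨le_rfl, hx.1.trans hx.2⟩ : (0 : ℝ) ∈ Set.Icc 0 a) hx
  rw [h0, sub_zero, sub_zero, Real.norm_eq_abs, Real.norm_eq_abs, abs_of_nonneg hx.1] at h
  have : 0 ≤ ε := (abs_nonneg _).trans (hb x hx)
  exact h.trans (by gcongr; exact hx.2)

theorem hasDerivAt_pow_div_factorial (n : ℕ) (hn : 1 ≤ n) (x : ℝ) :
    HasDerivAt (fun x : ℝ => x ^ n / n !) (x ^ (n - 1) / (n - 1)!) x := by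
  have h := (hasDerivAt_pow n x).div_const (n ! : ℝ)
  refine h.congr_deriv ?_
  obtain ⟨m, rfl⟩ : ∃ m, n = m + 1 := ⟨n - 1, by omega⟩
  simp only [Nat.add_sub_cancel, Nat.factorial_succ]
  push_cast
  have : (m ! : ℝ) ≠ 0 := by positivity
  field_simp

/-- The error and its derivative vanish at 0, so the mean value inequality applies twice. For k = 0,
p = 1 the truncated exponent 2k + p - 2 is harmless, its factor 2k + p - 1 being 0. -/
theorem abs_arcsinPartial_sub_le {p : ℕ} (hp : 1 ≤ p) (hp2 : p ≤ 2) (k M : ℕ) {a ε : ℝ}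
    (hb : ∀ x ∈ Set.Icc 0 a,
      |arcsinPartialDeriv₂ p k (M + 1) x - (2 * k + p - 1 : ℕ) *
        x ^ (2 * k + p - 2) / (2 * k + p - 1)!| ≤ ε) :
    ∀ x ∈ Set.Icc 0 a,
      |arcsinPartial p k (M + 1) x - x ^ (2 * k + p) / (2 * k + p)!| ≤ ε * a * a := by
  refine abs_le_of_abs_deriv_le
    (f' := fun x => arcsinPartialDeriv p k (M + 1) x - x ^ (2 * k + p - 1) / (2 * k + p - 1)!)
    ?_ ?_ (abs_le_of_abs_deriv_le
      (f' := fun x => arcsinPartialDeriv₂ p k (M + 1) x - (2 * k + p - 1 : ℕ) *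
        x ^ (2 * k + p - 2) / (2 * k + p - 1)!) ?_ ?_ hb)
  · simp [arcsinPartial_apply_zero hp, zero_pow (show 2 * k + p ≠ 0 by omega)]
  · exact fun x => (hasDerivAt_arcsinPartial p k _ x).sub
      (hasDerivAt_pow_div_factorial _ (by omega) x)
  · simp [arcsinPartialDeriv_apply_zero hp hp2]
  · exact fun x => (hasDerivAt_arcsinPartialDeriv p k _ x).sub
      ((hasDerivAt_pow (2 * k + p - 1) x).div_const _)

/-- Induction on k: the second derivative of the error at level k + 1 is the error at level k minus
a tail term. The tail is uniformly small because sin x ≤ sin a < 1 on [0, a]. -/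
theorem eventually_abs_arcsinPartial_sub_le {p : ℕ} (hp : 1 ≤ p) (hp2 : p ≤ 2) {a : ℝ}
    (h0 : 0 ≤ a) (ha : a < π / 2) (k : ℕ) {ε : ℝ} (hε : 0 < ε) :
    ∀ᶠ M in atTop, ∀ x ∈ Set.Icc 0 a,
      |arcsinPartial p k M x - x ^ (2 * k + p) / (2 * k + p)!| ≤ ε := by
  have hsin0 : 0 ≤ Real.sin a := Real.sin_nonneg_of_nonneg_of_le_pi h0 (by linarith)
  have hsin1 : Real.sin a < 1 := by
    rw [← Real.sin_pi_div_two]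
    exact Real.sin_lt_sin_of_lt_of_le_pi_div_two (by linarith) le_rfl ha
  have tail : ∀ k M x, x ∈ Set.Icc 0 a →
      |((2 * M + p : ℕ) : ℝ) ^ 2 * arcsinCoeff p k M * Real.sin x ^ (2 * M + p)|
        ≤ ((2 * M + p : ℕ) : ℝ) ^ 2 * arcsinCoeff p k M * Real.sin a ^ (2 * M + p) := by
    intro k M x hx
    have hx0 : 0 ≤ Real.sin x :=
      Real.sin_nonneg_of_nonneg_of_le_pi hx.1 (by linarith [hx.2])
    have hxa : Real.sin x ≤ Real.sin a :=
      Real.sin_le_sin_of_le_of_le_pi_div_two (by linarith [hx.1]) ha.le hx.2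
    have := arcsinCoeff_nonneg hp k M
    rw [abs_of_nonneg (by positivity)]
    gcongr
  have tail_small : ∀ k {δ : ℝ}, 0 < δ → ∀ᶠ M : ℕ in atTop,
      ((2 * M + p : ℕ) : ℝ) ^ 2 * arcsinCoeff p k M * Real.sin a ^ (2 * M + p) ≤ δ :=
    fun k δ hδ => (tendsto_sq_mul_arcsinCoeff_mul_pow hp hp2 k hsin0 hsin1).eventually_le_const hδ
  -- One δ pays for the tail, the other for the error at the previous level.
  have key : ∀ {ε : ℝ}, 0 < ε → ∃ δ > 0, (δ + δ) * a * a ≤ ε := by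
    intro ε hε
    refine ⟨ε / (2 * (a * a + 1)), by positivity, ?_⟩
    have : (ε / (2 * (a * a + 1)) + ε / (2 * (a * a + 1))) * a * a
      = ε * (a * a / (a * a + 1)) := by field_simp; ring
    rw [this]
    exact mul_le_of_le_one_right hε.le ((div_le_one (by positivity)).2 (by linarith))
  induction k generalizing ε with
  | zero =>
    obtain ⟨δ, hδ, hδε⟩ := key hε
    have h := tail_small 0 hδ
    rw [eventually_atTop] at h ⊢
    obtain ⟨M₀, hM⟩ := h
    refine ⟨M₀ + 1, fun M hM' => ?_⟩
    obtain ⟨M, rfl⟩ : ∃ m, M = m + 1 := ⟨M - 1, by omega⟩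
    refine fun x hx => (abs_arcsinPartial_sub_le hp hp2 0 M (ε := δ + δ) ?_ x hx).trans hδε
    intro x hx
    rw [arcsinPartialDeriv₂_zero hp hp2]
    have := (tail 0 M x hx).trans (hM M (by omega))
    have e : (((2 * 0 + p - 1 : ℕ) : ℝ) * x ^ (2 * 0 + p - 2) / (2 * 0 + p - 1)!) = p - 1 := by
      interval_cases p <;> norm_num
    rw [e, sub_sub_cancel_left, abs_neg]
    linarith
  | succ k ih =>
    obtain ⟨δ, hδ, hδε⟩ := key hε
    have h := (tail_small (k + 1) hδ).and (ih hδ)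
    rw [eventually_atTop] at h ⊢
    obtain ⟨M₀, hM⟩ := h
    refine ⟨M₀ + 1, fun M hM' => ?_⟩
    obtain ⟨M, rfl⟩ : ∃ m, M = m + 1 := ⟨M - 1, by omega⟩
    refine fun x hx => (abs_arcsinPartial_sub_le hp hp2 (k + 1) M (ε := δ + δ) ?_ x hx).trans hδε
    intro x hx
    rw [arcsinPartialDeriv₂_succ hp]
    have h1 := (tail (k + 1) M x hx).trans (hM M (by omega)).1
    have h2 := (hM M (by omega)).2 x hx
    have e : (((2 * (k + 1) + p - 1 : ℕ) : ℝ) * x ^ (2 * (k + 1) + p - 2)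
        / (2 * (k + 1) + p - 1)!) = x ^ (2 * k + p) / (2 * k + p)! := by
      rw [show 2 * (k + 1) + p - 1 = 2 * k + p + 1 by omega,
        show 2 * (k + 1) + p - 2 = 2 * k + p by omega, Nat.factorial_succ]
      push_cast
      have : ((2 * k + p)! : ℝ) ≠ 0 := by positivity
      have : (2 * k + p + 1 : ℝ) ≠ 0 := by positivity
      field_simp
    rw [e, sub_right_comm]
    exact (abs_sub _ _).trans (add_le_add h2 h1)

theorem tendsto_arcsinPartial {p : ℕ} (hp : 1 ≤ p) (hp2 : p ≤ 2) (k : ℕ) {x : ℝ}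
    (h0 : 0 ≤ x) (hx : x < π / 2) :
    Tendsto (fun M => arcsinPartial p k M x) atTop (𝓝 (x ^ (2 * k + p) / (2 * k + p)!)) := by
  rw [Metric.tendsto_atTop']
  intro ε hε
  have h := eventually_abs_arcsinPartial_sub_le hp hp2 h0 hx k (half_pos hε)
  obtain ⟨M₀, hM⟩ := eventually_atTop.1 h
  refine ⟨M₀, fun M hM' => ?_⟩
  rw [Real.dist_eq]
  linarith [hM M hM'.le x ⟨h0, le_rfl⟩]

/-! ### Integrability of the kernel and the sine expansion of the cotangent. -/

theorem sin_pos_of_mem_Ioo {x : ℝ} (hx : x ∈ Set.Ioo 0 (π / 2)) : 0 < Real.sin x :=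
  Real.sin_pos_of_pos_of_lt_pi hx.1 (by linarith [hx.2, Real.pi_pos])

/-- The quotient of `(π / 2 - x) * x ^ j` by `sin x`. -/
noncomputable def sinQuotient (j : ℕ) (x : ℝ) : ℝ := (π / 2 - x) * x ^ j / Real.sin x

theorem measurable_sinQuotient (j : ℕ) : Measurable (sinQuotient j) := by
  unfold sinQuotient
  fun_prop

theorem sinQuotient_nonneg (j : ℕ) {x : ℝ} (hx : x ∈ Set.Ioo 0 (π / 2)) :
    0 ≤ sinQuotient j x := by
  have := sin_pos_of_mem_Ioo hx
  have := hx.1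
  have : 0 ≤ π / 2 - x := by linarith [hx.2]
  unfold sinQuotient
  positivity

/-- Jordan's inequality 2x/π ≤ sin x absorbs the zero of sin x at 0 at the cost of one factor x,
whence 1 ≤ j. -/
theorem sinQuotient_le {j : ℕ} (hj : 1 ≤ j) {x : ℝ} (hx : x ∈ Set.Ioo 0 (π / 2)) :
    sinQuotient j x ≤ (π / 2) ^ (j + 1) := by
  have hs := sin_pos_of_mem_Ioo hx
  have hx0 := hx.1
  have hq : 0 ≤ π / 2 - x := by linarith [hx.2]
  have h := Real.mul_le_sin hx0.le hx.2.le
  have h' : x ≤ π / 2 * Real.sin x := by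
    calc x = π / 2 * (2 / π * x) := by field_simp
      _ ≤ _ := by gcongr
  obtain ⟨i, rfl⟩ : ∃ i, j = i + 1 := ⟨j - 1, by omega⟩
  rw [sinQuotient, div_le_iff₀ hs]
  calc (π / 2 - x) * x ^ (i + 1) = (π / 2 - x) * x ^ i * x := by ring
    _ ≤ (π / 2) * (π / 2) ^ i * (π / 2 * Real.sin x) := by
        gcongr
        · linarith
        · exact hx.2.le
    _ = _ := by ring

theorem ae_mem_Ioo : ∀ᵐ x, x ∈ Set.uIoc 0 (π / 2) → x ∈ Set.Ioo 0 (π / 2) := by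
  filter_upwards [MeasureTheory.Measure.ae_ne MeasureTheory.volume (π / 2)] with x hx h
  rw [Set.uIoc_of_le (by positivity)] at h
  exact ⟨h.1, lt_of_le_of_ne h.2 hx⟩

theorem intervalIntegrable_sinQuotient {j : ℕ} (hj : 1 ≤ j) :
    IntervalIntegrable (sinQuotient j) MeasureTheory.volume 0 (π / 2) := by
  refine (intervalIntegrable_const (c := (π / 2) ^ (j + 1))).mono_fun
    (measurable_sinQuotient j).aestronglyMeasurable ?_
  rw [Filter.EventuallyLE, MeasureTheory.ae_restrict_iff' measurableSet_uIoc]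
  filter_upwards [ae_mem_Ioo] with x hx h
  rw [Real.norm_of_nonneg (sinQuotient_nonneg j (hx h)), Real.norm_of_nonneg (by positivity)]
  exact sinQuotient_le hj (hx h)

/-- The Riemann-Lebesgue lemma for the cosine transform on an interval. -/
theorem tendsto_integral_mul_cos {f : ℝ → ℝ} {a b : ℝ} (hab : a ≤ b)
    (hf : IntervalIntegrable f MeasureTheory.volume a b) :
    Tendsto (fun t : ℝ => ∫ x in a..b, f x * Real.cos (t * x)) atTop (𝓝 0) := by
  have h := Real.tendsto_integral_exp_smul_cocompact
    ((Set.Ioc a b).indicator fun x => (f x : ℂ))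
  -- The Fourier character is exp(2πi ·), so frequency t corresponds to t / (2π).
  have h2 : Tendsto (fun t : ℝ => t / (2 * π)) atTop (cocompact ℝ) :=
    (tendsto_id.atTop_div_const (by positivity)).mono_right atTop_le_cocompact
  have h3 := (Complex.continuous_re.tendsto _).comp (h.comp h2)
  refine h3.congr fun t => ?_
  have hi : MeasureTheory.Integrable ((Set.Ioc a b).indicator fun x => (f x : ℂ)) := by
    rw [MeasureTheory.integrable_indicator_iff measurableSet_Ioc]
    exact ((intervalIntegrable_iff_integrableOn_Ioc_of_le hab).1 hf).ofReal
  have hi2 := (Real.fourierIntegral_convergent_iff (t / (2 * π))).2 hi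
  have e : ∀ v : ℝ, (Real.fourierChar (-(v * (t / (2 * π))))
      • ((Set.Ioc a b).indicator fun x => (f x : ℂ)) v)
      = (Set.Ioc a b).indicator (fun v => Complex.exp (((-(t * v) : ℝ) : ℂ) * Complex.I) * f v) v := by
    intro v
    by_cases hv : v ∈ Set.Ioc a b
    · rw [Set.indicator_of_mem hv, Set.indicator_of_mem hv, Circle.smul_def, smul_eq_mul,
        Real.fourierChar_apply]
      congr 4
      field_simp
    · rw [Set.indicator_of_notMem hv, Set.indicator_of_notMem hv, smul_zero]
  have hi3 : MeasureTheory.IntegrableOn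
      (fun v => Complex.exp (((-(t * v) : ℝ) : ℂ) * Complex.I) * f v) (Set.Ioc a b) := by
    rw [← MeasureTheory.integrable_indicator_iff measurableSet_Ioc]
    refine hi2.congr (Eventually.of_forall fun v => ?_)
    simp only [← e]
    congr 3
    simp [mul_comm]
  simp only [Function.comp_apply, e]
  rw [MeasureTheory.integral_indicator measurableSet_Ioc, integral_of_le hab]
  have := integral_re hi3
  simp only [RCLike.re_to_complex] at this
  rw [← this]
  refine MeasureTheory.integral_congr_ae (Eventually.of_forall fun v => ?_)
  simp only [Complex.re_mul_ofReal, Complex.exp_ofReal_mul_I_re, Real.cos_neg]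
  ring

/-- Finite form of cot x = 2 ∑ sin 2nx; the error is cos((2M+1)x) / sin x. -/
theorem two_mul_sin_mul_sum_sin (M : ℕ) (x : ℝ) :
    Real.sin x * (2 * ∑ n ∈ range M, Real.sin (2 * (n + 1 : ℕ) * x))
      = Real.cos x - Real.cos ((2 * M + 1) * x) := by
  induction M with
  | zero => simp
  | succ M ih =>
    rw [sum_range_succ, mul_add, mul_add, ih]
    have h1 : (2 * ((M + 1 : ℕ) : ℝ) + 1) * x = 2 * (M + 1 : ℕ) * x + x := by ring
    have h2 : (2 * (M : ℝ) + 1) * x = 2 * (M + 1 : ℕ) * x - x := by push_cast; ring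
    rw [h1, h2, Real.cos_add, Real.cos_sub]
    ring

/-! ### Sine moments and the integral against the cotangent. -/

/-- The sine moments `∫ x ^ m * sin (2 n x)` over a quarter period. -/
noncomputable def sinMoment (m n : ℕ) : ℝ :=
  ∫ x in (0 : ℝ)..(π / 2), x ^ m * Real.sin (2 * n * x)

theorem sinMoment_recurrence (m : ℕ) {n : ℕ} (hn : n ≠ 0) :
    sinMoment m n + m * (m - 1) / (4 * n ^ 2) * sinMoment (m - 2) n
      = 0 ^ m / (2 * n) - (π / 2) ^ m * (-1) ^ n / (2 * n) := by
  have hn' : (n : ℝ) ≠ 0 := by exact_mod_cast hn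
  -- The antiderivative comes from two integrations by parts. For m ≤ 1 the truncated exponent m - 2
  -- is multiplied by m(m - 1) = 0.
  have hd : ∀ x : ℝ, HasDerivAt
      (fun x => -(x ^ m * Real.cos (2 * n * x)) / (2 * n)
        + m * x ^ (m - 1) * Real.sin (2 * n * x) / (4 * n ^ 2))
      (x ^ m * Real.sin (2 * n * x)
        + m * (m - 1) / (4 * n ^ 2) * (x ^ (m - 2) * Real.sin (2 * n * x))) x := by
    intro x
    have hl : HasDerivAt (fun x : ℝ => 2 * n * x) (2 * n) x := by
      simpa using (hasDerivAt_id x).const_mul (2 * n : ℝ)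
    have h1 := (((hasDerivAt_pow m x).mul hl.cos).neg).div_const (2 * n : ℝ)
    have h2 := (((hasDerivAt_pow (m - 1) x).const_mul (m : ℝ)).mul hl.sin).div_const
      (4 * n ^ 2 : ℝ)
    refine (h1.add h2).congr_deriv ?_
    rcases m with _ | _ | m
    · simp
      field_simp
    · simp
      field_simp
      ring
    · simp only [Nat.add_sub_cancel, show m + 1 + 1 - 2 = m by omega,
        show m + 1 - 1 = m by omega]
      push_cast
      field_simp
      ring
  have hi := integral_eq_sub_of_hasDerivAt (a := 0) (b := π / 2) (fun x _ => hd x)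
    (Continuous.intervalIntegrable (by fun_prop) _ _)
  rw [integral_add (Continuous.intervalIntegrable (by fun_prop) _ _)
    (Continuous.intervalIntegrable (by fun_prop) _ _), integral_const_mul] at hi
  rw [sinMoment, sinMoment, hi]
  have e : 2 * (n : ℝ) * (π / 2) = n * π := by ring
  rw [e, Real.cos_nat_mul_pi, Real.sin_nat_mul_pi]
  simp
  ring

/-- The sine moments without their leading term in `1 / n`. -/
noncomputable def sinRemainder (m n : ℕ) : ℝ :=
  sinMoment m n + (π / 2) ^ m * (-1) ^ n / (2 * n)

theorem sinRemainder_zero {n : ℕ} (hn : n ≠ 0) : sinRemainder 0 n = 1 / (2 * n) := by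
  have h := sinMoment_recurrence 0 hn
  simp at h
  rw [sinRemainder, h]
  simp

theorem sinRemainder_one {n : ℕ} (hn : n ≠ 0) : sinRemainder 1 n = 0 := by
  have h := sinMoment_recurrence 1 hn
  simp at h
  rw [sinRemainder, h]
  simp

theorem sinRemainder_add_two (m : ℕ) {n : ℕ} (hn : n ≠ 0) :
    sinRemainder (m + 2) n = -((m + 2) * (m + 1) / 4) *
      (sinRemainder m n / n ^ 2 - (π / 2) ^ m / 2 * ((-1) ^ n / n ^ 3)) := by
  have hn' : (n : ℝ) ≠ 0 := by exact_mod_cast hn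
  have h := sinMoment_recurrence (m + 2) hn
  rw [show m + 2 - 2 = m by omega, zero_pow (by omega)] at h
  push_cast at h
  rw [sinRemainder, eq_sub_of_add_eq h, sinRemainder]
  field_simp
  ring

/-- The weight π/2 - x cancels the leading 1/n terms of the two moments, so moments may be replaced
by remainders. -/
theorem sum_sinRemainder {j : ℕ} (hj : 1 ≤ j) (M : ℕ) :
    2 * ∑ n ∈ range M, (π / 2 * sinRemainder j (n + 1) - sinRemainder (j + 1) (n + 1))
      = (∫ x in (0 : ℝ)..(π / 2), sinQuotient j x * Real.cos x)
        - ∫ x in (0 : ℝ)..(π / 2), sinQuotient j x * Real.cos ((2 * M + 1) * x) := by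
  have hq := intervalIntegrable_sinQuotient hj
  rw [← integral_sub (hq.mul_continuousOn (by fun_prop)) (hq.mul_continuousOn (by fun_prop))]
  have e1 : ∀ n : ℕ, π / 2 * sinRemainder j (n + 1) - sinRemainder (j + 1) (n + 1)
      = ∫ x in (0 : ℝ)..(π / 2), (π / 2 - x) * x ^ j * Real.sin (2 * (n + 1 : ℕ) * x) := by
    intro n
    have : ∀ x : ℝ, (π / 2 - x) * x ^ j * Real.sin (2 * (n + 1 : ℕ) * x)
        = π / 2 * (x ^ j * Real.sin (2 * (n + 1 : ℕ) * x))
          - x ^ (j + 1) * Real.sin (2 * (n + 1 : ℕ) * x) := fun x => by ring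
    simp only [this]
    rw [integral_sub (Continuous.intervalIntegrable (by fun_prop) _ _)
      (Continuous.intervalIntegrable (by fun_prop) _ _), integral_const_mul]
    simp only [sinRemainder, sinMoment]
    ring
  simp only [e1]
  rw [← integral_finsetSum (fun i _ => Continuous.intervalIntegrable (by fun_prop) _ _),
    ← integral_const_mul]
  refine integral_congr_ae ?_
  filter_upwards [ae_mem_Ioo] with x hx h
  have hs := (sin_pos_of_mem_Ioo (hx h)).ne'
  rw [← mul_sub, ← two_mul_sin_mul_sum_sin, ← mul_sum, sinQuotient]
  field_simp

theorem integral_sinQuotient_mul_cos_eq {j : ℕ} (hj : 1 ≤ j) {A B : ℝ}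
    (hA : HasSum (fun n => sinRemainder j (n + 1)) A)
    (hB : HasSum (fun n => sinRemainder (j + 1) (n + 1)) B) :
    ∫ x in (0 : ℝ)..(π / 2), sinQuotient j x * Real.cos x = π * A - 2 * B := by
  have h1 := (((hA.mul_left (π / 2)).sub hB).tendsto_sum_nat).const_mul 2
  simp only [sum_sinRemainder hj] at h1
  have h2 := (tendsto_integral_mul_cos (by positivity) (intervalIntegrable_sinQuotient hj)).comp
    ((tendsto_natCast_atTop_atTop (R := ℝ)).const_mul_atTop (two_pos)
      |>.atTop_add (tendsto_const_nhds (x := (1 : ℝ))))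
  have h3 := tendsto_nhds_unique h1 (tendsto_const_nhds.sub h2)
  linarith

/-! ### Termwise integration of the expansion. -/

theorem integral_mul_cos_mul_sin_pow (n : ℕ) :
    ∫ x in (0 : ℝ)..(π / 2), (π / 2 - x) * Real.cos x * Real.sin x ^ n
      = wallis (n + 1) / (n + 1) := by
  have hd : ∀ x : ℝ, HasDerivAt (fun x => (π / 2 - x) * Real.sin x ^ (n + 1) / (n + 1))
      ((π / 2 - x) * Real.cos x * Real.sin x ^ n - Real.sin x ^ (n + 1) / (n + 1)) x := by
    intro x
    have h := (((hasDerivAt_id x).const_sub (π / 2)).mul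
      (hasDerivAt_sin_pow (n + 1) x)).div_const (n + 1 : ℝ)
    refine h.congr_deriv ?_
    have : (n + 1 : ℝ) ≠ 0 := by positivity
    simp
    field_simp
    ring
  have hi := integral_eq_sub_of_hasDerivAt (a := 0) (b := π / 2) (fun x _ => hd x)
    (Continuous.intervalIntegrable (by fun_prop) _ _)
  rw [integral_sub (Continuous.intervalIntegrable (by fun_prop) _ _)
    (Continuous.intervalIntegrable (by fun_prop) _ _), integral_div] at hi
  simp at hi
  rw [wallis]
  linarith

theorem arcsinPartial_mono {p : ℕ} (hp : 1 ≤ p) (k : ℕ) {x : ℝ} (hx : 0 ≤ Real.sin x) :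
    Monotone fun M => arcsinPartial p k M x := by
  refine monotone_nat_of_le_succ fun M => ?_
  rw [arcsinPartial, arcsinPartial, sum_range_succ]
  have := arcsinCoeff_nonneg hp k M
  have : 0 ≤ arcsinCoeff p k M * Real.sin x ^ (2 * M + p) := by positivity
  linarith

theorem sum_nestedSum_eq_integral {p : ℕ} (hp : 1 ≤ p) (k M : ℕ) :
    ∑ i ∈ range M, wallisConst p * (nestedSum p k i / ((2 * i + p : ℕ) : ℝ) ^ 3)
      = ∫ x in (0 : ℝ)..(π / 2),
          sinQuotient 0 x * Real.cos x * arcsinPartial p k M x := by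
  have e : ∀ i, wallisConst p * (nestedSum p k i / ((2 * i + p : ℕ) : ℝ) ^ 3)
      = ∫ x in (0 : ℝ)..(π / 2),
        arcsinCoeff p k i * ((π / 2 - x) * Real.cos x * Real.sin x ^ (2 * i + p - 1)) := by
    intro i
    have hw := wallis_pos (2 * i + p)
    rw [integral_const_mul, integral_mul_cos_mul_sin_pow, arcsinCoeff]
    obtain ⟨n, hn⟩ : ∃ n, 2 * i + p = n + 1 := ⟨2 * i + p - 1, by omega⟩
    rw [hn] at hw ⊢
    simp only [Nat.add_sub_cancel]
    push_cast
    have : (n + 1 : ℝ) ≠ 0 := by positivity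
    field_simp
  simp only [e]
  rw [← integral_finsetSum (fun i _ => Continuous.intervalIntegrable (by fun_prop) _ _)]
  refine integral_congr_ae ?_
  filter_upwards [ae_mem_Ioo] with x hx h
  have hs := (sin_pos_of_mem_Ioo (hx h)).ne'
  rw [arcsinPartial, mul_sum]
  refine sum_congr rfl fun i _ => ?_
  obtain ⟨n, hn⟩ : ∃ n, 2 * i + p = n + 1 := ⟨2 * i + p - 1, by omega⟩
  rw [hn, sinQuotient, Nat.add_sub_cancel]
  field_simp
  ring

theorem hasSum_nestedSum_div {p : ℕ} (hp : 1 ≤ p) (hp2 : p ≤ 2) (k : ℕ) :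
    HasSum (fun i => wallisConst p * (nestedSum p k i / ((2 * i + p : ℕ) : ℝ) ^ 3))
      ((∫ x in (0 : ℝ)..(π / 2), sinQuotient (2 * k + p) x * Real.cos x)
        / (2 * k + p)!) := by
  have hK := wallisConst_pos hp
  rw [hasSum_iff_tendsto_nat_of_nonneg]
  swap
  · intro i
    have := nestedSum_nonneg p k i
    positivity
  simp only [sum_nestedSum_eq_integral hp]
  rw [← integral_div]
  have hlim : ∀ x ∈ Set.Ioo 0 (π / 2), Tendsto
      (fun M => sinQuotient 0 x * Real.cos x * arcsinPartial p k M x) atTop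
      (𝓝 (sinQuotient (2 * k + p) x * Real.cos x / (2 * k + p)!)) := by
    intro x hx
    have h := (tendsto_arcsinPartial hp hp2 k hx.1.le hx.2).const_mul
      (sinQuotient 0 x * Real.cos x)
    have e : sinQuotient 0 x * Real.cos x * (x ^ (2 * k + p) / (2 * k + p)!)
        = sinQuotient (2 * k + p) x * Real.cos x / (2 * k + p)! := by
      simp only [sinQuotient]
      ring
    rwa [e] at h
  refine tendsto_integral_filter_of_dominated_convergence
    (fun x => sinQuotient (2 * k + p) x * Real.cos x / (2 * k + p)!) ?_ ?_ ?_ ?_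
  · refine Eventually.of_forall fun M => Measurable.aestronglyMeasurable ?_
    have h1 := measurable_sinQuotient 0
    have h2 : Measurable (arcsinPartial p k M) := by
      unfold arcsinPartial
      fun_prop
    fun_prop
  · refine Eventually.of_forall fun M => ?_
    filter_upwards [ae_mem_Ioo] with x hx h
    have hc : 0 ≤ Real.cos x :=
      Real.cos_nonneg_of_neg_pi_div_two_le_of_le (by linarith [(hx h).1, Real.pi_pos]) (hx h).2.le
    have hs := (sin_pos_of_mem_Ioo (hx h)).le
    have h0 := mul_nonneg (sinQuotient_nonneg 0 (hx h)) hc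
    -- The partial sums increase to the limit, so the limit itself is the dominating function.
    have hm : Monotone fun M => sinQuotient 0 x * Real.cos x * arcsinPartial p k M x :=
      (arcsinPartial_mono hp k hs).const_mul h0
    have hnn : 0 ≤ arcsinPartial p k M x := by
      simpa [arcsinPartial] using arcsinPartial_mono hp k hs (Nat.zero_le M)
    rw [Real.norm_of_nonneg (mul_nonneg h0 hnn)]
    exact hm.ge_of_tendsto (hlim x (hx h)) M
  · exact ((intervalIntegrable_sinQuotient (by omega)).mul_continuousOn
      (by fun_prop)).div_const _
  · filter_upwards [ae_mem_Ioo] with x hx h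
    exact hlim x (hx h)

/-! ### Weights, zeta values and sums of remainders. -/

theorem smul_mem_gradedPart {N d : ℕ} {x : ℝ} (q : ℚ) (hx : (x : ℂ) ∈ gradedPart N d) :
    ((q * x : ℝ) : ℂ) ∈ gradedPart N d := by
  have := (gradedPart N d).smul_mem q hx
  rw [Rat.smul_def] at this
  exact_mod_cast this

theorem mul_mem_gradedPart {N d e : ℕ} {x y : ℝ} (hx : (x : ℂ) ∈ gradedPart N d)
    (hy : (y : ℂ) ∈ gradedPart N e) : ((x * y : ℝ) : ℂ) ∈ gradedPart N (d + e) := by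
  obtain ⟨P, hP, hPx⟩ := hx
  obtain ⟨Q, hQ, hQy⟩ := hy
  refine ⟨P * Q, ?_, ?_⟩
  · exact MvPolynomial.IsWeightedHomogeneous.mul hP hQ
  · simp only [AlgHom.toLinearMap_apply] at *
    rw [map_mul, hPx, hQy]
    push_cast
    rfl

theorem sub_mem_gradedPart {N d : ℕ} {x y : ℝ} (hx : (x : ℂ) ∈ gradedPart N d)
    (hy : (y : ℂ) ∈ gradedPart N d) : ((x - y : ℝ) : ℂ) ∈ gradedPart N d := by
  rw [Complex.ofReal_sub]
  exact Submodule.sub_mem _ hx hy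

theorem generator_mem_gradedPart (N : ℕ) (i : Fin (N + 2)) :
    generator N i ∈ gradedPart N (degree N i) :=
  ⟨MvPolynomial.X i, MvPolynomial.isWeightedHomogeneous_X ℚ (degree N) i, by simp⟩

theorem pi_mem_gradedPart (N : ℕ) : (π : ℂ) ∈ gradedPart N 1 :=
  generator_mem_gradedPart N 0

theorem pi_pow_mem_gradedPart (N m : ℕ) : ((π ^ m : ℝ) : ℂ) ∈ gradedPart N m := by
  induction m with
  | zero => exact ⟨1, MvPolynomial.isWeightedHomogeneous_one ℚ (degree N), by simp⟩
  | succ m ih => exact mul_mem_gradedPart ih (pi_mem_gradedPart N)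

theorem hasSum_one_div_pow {N s : ℕ} (hs : s ≤ N) :
    ∃ Z : ℝ, (Z : ℂ) ∈ gradedPart N (2 * s + 3) ∧
      HasSum (fun n : ℕ => 1 / ((n + 1 : ℕ) : ℝ) ^ (2 * s + 3)) Z := by
  have hsum : Summable fun n : ℕ => 1 / (n : ℝ) ^ (2 * s + 3) :=
    Real.summable_one_div_nat_pow.2 (by omega)
  refine ⟨∑' n : ℕ, 1 / (n : ℝ) ^ (2 * s + 3), ?_, ?_⟩
  · have h := generator_mem_gradedPart N (Fin.succ ⟨s, by omega⟩)
    simp only [generator, degree, Fin.cons_succ] at h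
    rw [zeta_nat_eq_tsum_of_gt_one (by omega)] at h
    rw [Complex.ofReal_tsum]
    push_cast
    exact h
  -- The shift by one drops only the term 1 / 0 = 0.
  · rw [hasSum_nat_add_iff (f := fun n : ℕ => 1 / (n : ℝ) ^ (2 * s + 3)) 1]
    simpa using hsum.hasSum

/-- In the application f n belongs to the integer n + 1, so odd indices carry the even integers,
whose sum is a rational multiple of Z. -/
theorem hasSum_neg_one_pow_succ_mul {f : ℕ → ℝ} {Z c : ℝ} (h : HasSum f Z)
    (hodd : HasSum (fun n => f (2 * n + 1)) c) :
    HasSum (fun n => (-1) ^ (n + 1) * f n) (2 * c - Z) := by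
  have hinj : Function.Injective fun n : ℕ => 2 * n := fun a b hab => by simpa using hab
  have heven : HasSum (fun n => f (2 * n)) (Z - c) := by
    have hs : HasSum (fun n => f (2 * n)) _ := (h.summable.comp_injective hinj).hasSum
    rw [← (hs.even_add_odd hodd).unique h, add_sub_cancel_right]
    exact hs
  rw [show 2 * c - Z = -(Z - c) + c by ring]
  refine HasSum.even_add_odd (f := fun n => (-1) ^ (n + 1) * f n)
    (heven.neg.congr_fun fun n => ?_) (hodd.congr_fun fun n => ?_)
  · rw [Odd.neg_one_pow ⟨n, rfl⟩, neg_one_mul]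
  · rw [Even.neg_one_pow ⟨n + 1, by ring⟩, one_mul]

theorem hasSum_neg_one_pow_div_pow {N s : ℕ} (hs : s ≤ N) :
    ∃ Z : ℝ, (Z : ℂ) ∈ gradedPart N (2 * s + 3) ∧
      HasSum (fun n : ℕ => (-1) ^ (n + 1) / ((n + 1 : ℕ) : ℝ) ^ (2 * s + 3)) Z := by
  obtain ⟨Z, hZ, h⟩ := hasSum_one_div_pow hs
  have hodd : HasSum (fun n : ℕ => 1 / ((2 * n + 1 + 1 : ℕ) : ℝ) ^ (2 * s + 3))
      (((1 / 2 ^ (2 * s + 3) : ℚ) : ℝ) * Z) := by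
    refine (h.mul_left _).congr_fun fun n => ?_
    push_cast
    rw [show (2 * n + 1 + 1 : ℝ) = 2 * (n + 1) by ring, mul_pow]
    field_simp
  refine ⟨_, ?_, (hasSum_neg_one_pow_succ_mul h hodd).congr_fun fun n => by
    rw [mul_one_div]⟩
  have e : 2 * (((1 / 2 ^ (2 * s + 3) : ℚ) : ℝ) * Z) - Z
      = ((2 / 2 ^ (2 * s + 3) - 1 : ℚ) : ℝ) * Z := by
    push_cast
    ring
  rw [e]
  exact smul_mem_gradedPart _ hZ

/-- The recurrence trades a step in k for a factor 1/n^2, so s is generalised and k + s stays fixed.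
The lower bound excludes the harmonic series; the upper one keeps zeta arguments at most 2N + 3. -/
theorem hasSum_sinRemainder_even {N : ℕ} (k s : ℕ) (h1 : 1 ≤ k + s) (h2 : k + s ≤ N + 1) :
    ∃ X : ℝ, (X : ℂ) ∈ gradedPart N (2 * k + 1 + 2 * s) ∧
      HasSum (fun n => sinRemainder (2 * k) (n + 1) / ((n + 1 : ℕ) : ℝ) ^ (2 * s)) X := by
  induction k generalizing s with
  | zero =>
    obtain ⟨t, rfl⟩ : ∃ t, s = t + 1 := ⟨s - 1, by omega⟩
    obtain ⟨Z, hZ, h⟩ := hasSum_one_div_pow (N := N) (s := t) (by omega)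
    refine ⟨((1 / 2 : ℚ) : ℝ) * Z, ?_, (h.mul_left _).congr_fun fun n => ?_⟩
    · rw [show 2 * 0 + 1 + 2 * (t + 1) = 2 * t + 3 by ring]
      exact smul_mem_gradedPart _ hZ
    · rw [mul_zero, sinRemainder_zero (by omega)]
      push_cast
      field_simp
      ring
  | succ k ih =>
    obtain ⟨X, hX, h⟩ := ih (s + 1) (by omega) (by omega)
    obtain ⟨Z, hZ, h'⟩ := hasSum_neg_one_pow_div_pow (N := N) (s := s) (by omega)
    refine ⟨((-((2 * k + 2) * (2 * k + 1) / 4) : ℚ) : ℝ) *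
      (X - ((1 / 2 ^ (2 * k + 1) : ℚ) : ℝ) * (π ^ (2 * k) * Z)), ?_,
      ((h.sub ((h'.mul_left _).mul_left _)).mul_left _).congr_fun fun n => ?_⟩
    · rw [show 2 * (k + 1) + 1 + 2 * s = 2 * k + 1 + 2 * (s + 1) by ring]
      refine smul_mem_gradedPart _ (sub_mem_gradedPart hX (smul_mem_gradedPart _ ?_))
      rw [show 2 * k + 1 + 2 * (s + 1) = 2 * k + (2 * s + 3) by ring]
      exact mul_mem_gradedPart (pi_pow_mem_gradedPart N _) hZ
    · rw [show 2 * (k + 1) = 2 * k + 2 by ring, sinRemainder_add_two _ (by omega),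
        div_pow]
      have hx : ((n + 1 : ℕ) : ℝ) ≠ 0 := by positivity
      generalize ((n + 1 : ℕ) : ℝ) = x at hx ⊢
      push_cast
      field_simp
      ring

/-- The recursion ends at remainder 1, which is zero. Only alternating sums times odd powers of π
remain, so a factor π splits off. -/
theorem hasSum_sinRemainder_odd {N : ℕ} (k s : ℕ) (h2 : k + s ≤ N + 1) :
    ∃ Y : ℝ, (Y : ℂ) ∈ gradedPart N (2 * k + 1 + 2 * s) ∧
      HasSum (fun n => sinRemainder (2 * k + 1) (n + 1) / ((n + 1 : ℕ) : ℝ) ^ (2 * s))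
        (π * Y) := by
  induction k generalizing s with
  | zero =>
    refine ⟨0, by simp, ?_⟩
    have h : (fun n => sinRemainder (2 * 0 + 1) (n + 1) / ((n + 1 : ℕ) : ℝ) ^ (2 * s))
        = fun _ => 0 := by
      funext n
      rw [mul_zero, zero_add, sinRemainder_one (by omega), zero_div]
    rw [h, mul_zero π]
    exact hasSum_zero
  | succ k ih =>
    obtain ⟨Y, hY, h⟩ := ih (s + 1) (by omega)
    obtain ⟨Z, hZ, h'⟩ := hasSum_neg_one_pow_div_pow (N := N) (s := s) (by omega)
    refine ⟨((-((2 * k + 3) * (2 * k + 2) / 4) : ℚ) : ℝ) *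
      (Y - ((1 / 2 ^ (2 * k + 2) : ℚ) : ℝ) * (π ^ (2 * k) * Z)), ?_, ?_⟩
    · rw [show 2 * (k + 1) + 1 + 2 * s = 2 * k + 1 + 2 * (s + 1) by ring]
      refine smul_mem_gradedPart _ (sub_mem_gradedPart hY (smul_mem_gradedPart _ ?_))
      rw [show 2 * k + 1 + 2 * (s + 1) = 2 * k + (2 * s + 3) by ring]
      exact mul_mem_gradedPart (pi_pow_mem_gradedPart N _) hZ
    · have e : π * (((-((2 * k + 3) * (2 * k + 2) / 4) : ℚ) : ℝ) *
          (Y - ((1 / 2 ^ (2 * k + 2) : ℚ) : ℝ) * (π ^ (2 * k) * Z)))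
          = ((-((2 * k + 3) * (2 * k + 2) / 4) : ℚ) : ℝ) *
          (π * Y - ((1 / 2 ^ (2 * k + 2) : ℚ) : ℝ) * (π ^ (2 * k + 1) * Z)) := by ring
      rw [e]
      refine ((h.sub ((h'.mul_left _).mul_left _)).mul_left _).congr_fun fun n => ?_
      rw [show 2 * (k + 1) + 1 = 2 * k + 1 + 2 by ring, sinRemainder_add_two _ (by omega),
        div_pow]
      have hx : ((n + 1 : ℕ) : ℝ) ≠ 0 := by positivity
      generalize ((n + 1 : ℕ) : ℝ) = x at hx ⊢
      push_cast
      field_simp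
      ring

/-! ### Evaluation of the two series of nested sums. -/

theorem hasSum_nestedSum_one (N : ℕ) :
    ∃ S : ℝ, (S : ℂ) ∈ gradedPart N (2 * N + 3) ∧
      HasSum (fun i => nestedSum 1 N i / ((2 * i + 1 : ℕ) : ℝ) ^ 3) S := by
  obtain ⟨Y, hY, hA⟩ := hasSum_sinRemainder_odd (N := N) N 0 (by omega)
  obtain ⟨X, hX, hB⟩ := hasSum_sinRemainder_even (N := N) (N + 1) 0 (by omega) (by omega)
  simp only [mul_zero, pow_zero, div_one, add_zero] at hA hB hX hY
  have h := hasSum_nestedSum_div le_rfl one_le_two N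
  rw [integral_sinQuotient_mul_cos_eq (by omega) hA hB] at h
  refine ⟨_, ?_, h.congr_fun fun i => ?_⟩
  · have e : (π * (π * Y) - 2 * X) / (2 * N + 1)!
        = ((1 / (2 * N + 1)! : ℚ) : ℝ) * (π ^ 2 * Y - ((2 : ℚ) : ℝ) * X) := by
      push_cast
      ring
    rw [e]
    refine smul_mem_gradedPart _ (sub_mem_gradedPart ?_ (smul_mem_gradedPart _ hX))
    rw [show 2 * N + 3 = 2 + (2 * N + 1) by ring]
    exact mul_mem_gradedPart (pi_pow_mem_gradedPart N 2) hY
  · simp [wallisConst, wallis_one]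

theorem hasSum_nestedSum_two (N : ℕ) :
    ∃ S : ℝ, (S : ℂ) ∈ gradedPart N (2 * N + 3) ∧
      HasSum (fun i => nestedSum 2 N i / ((2 * i + 2 : ℕ) : ℝ) ^ 3) S := by
  obtain ⟨X, hX, hA⟩ := hasSum_sinRemainder_even (N := N) (N + 1) 0 (by omega) (by omega)
  obtain ⟨Y, hY, hB⟩ := hasSum_sinRemainder_odd (N := N) (N + 1) 0 (by omega)
  simp only [mul_zero, pow_zero, div_one, add_zero] at hA hB hX hY
  have h := hasSum_nestedSum_div one_le_two le_rfl N
  rw [integral_sinQuotient_mul_cos_eq (j := 2 * N + 2) (by omega) hA hB] at h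
  -- 2 / π is the inverse of `wallisConst 2`; it cancels the common factor π of the integral.
  refine ⟨_, ?_, (h.mul_left (2 / π)).congr_fun fun i => ?_⟩
  · have e : 2 / π * ((π * X - 2 * (π * Y)) / (2 * N + 2)!)
        = ((2 / (2 * N + 2)! : ℚ) : ℝ) * (X - ((2 : ℚ) : ℝ) * Y) := by
      push_cast
      field_simp
    rw [e]
    exact smul_mem_gradedPart _ (sub_mem_gradedPart hX (smul_mem_gradedPart _ hY))
  · simp only [wallisConst, wallis_two]
    norm_num
    field_simp

/-! ### From nested sums to sums over decreasing tuples. -/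

theorem hasSum_sigma_of_nonneg {α : Type*} {β : α → Type*} {f : (Σ a, β a) → ℝ} {g : α → ℝ}
    {s : ℝ} (hf : ∀ x, 0 ≤ f x) (hg : ∀ a, HasSum (fun b => f ⟨a, b⟩) (g a)) (hs : HasSum g s) :
    HasSum f s := by
  have h : Summable f := by
    rw [summable_sigma_of_nonneg hf]
    refine ⟨fun a => (hg a).summable, ?_⟩
    simpa only [(hg _).tsum_eq] using hs.summable
  have := h.hasSum.sigma hg
  rw [hs.unique this]
  exact h.hasSum

/-- Strictly decreasing `k`-tuples of natural numbers below `n`. -/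
abbrev BoundedAnti (k n : ℕ) : Type := {i : Fin k → ℕ // StrictAnti i ∧ ∀ j, i j < n}

theorem strictAnti_cons_iff {k m : ℕ} {i : Fin k → ℕ} :
    StrictAnti (Fin.cons m i : Fin (k + 1) → ℕ) ↔ StrictAnti i ∧ ∀ j, i j < m := by
  refine ⟨fun h => ⟨fun a b hab => ?_, fun j => ?_⟩, fun ⟨h, hm⟩ a b hab => ?_⟩
  · simpa using h (Fin.succ_lt_succ_iff.2 hab)
  · simpa using h (Fin.succ_pos j)
  · cases a using Fin.cases with
    | zero =>
      cases b using Fin.cases with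
      | zero => exact absurd hab (lt_irrefl _)
      | succ b => simpa using hm b
    | succ a =>
      cases b using Fin.cases with
      | zero => exact absurd hab (Fin.not_lt_zero _)
      | succ b => simpa using h (Fin.succ_lt_succ_iff.1 hab)

/-- Splitting off the largest entry of a strictly decreasing tuple. -/
def strictAntiConsEquiv (k : ℕ) :
    (Σ m : ℕ, BoundedAnti k m) ≃ {i : Fin (k + 1) → ℕ // StrictAnti i} where
  toFun x := ⟨Fin.cons x.1 x.2.1, strictAnti_cons_iff.2 x.2.2⟩
  invFun i := ⟨i.1 0, Fin.tail i.1, strictAnti_cons_iff.1 (by rw [Fin.cons_self_tail]; exact i.2)⟩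
  left_inv _ := rfl
  right_inv i := by simp

theorem strictAntiConsEquiv_coe {k m : ℕ} (i : BoundedAnti k m) :
    (strictAntiConsEquiv k ⟨m, i⟩ : Fin (k + 1) → ℕ) = Fin.cons m i.1 := rfl

/-- Splitting off the largest entry of a strictly decreasing tuple with bounded entries. -/
def boundedAntiConsEquiv (k n : ℕ) :
    (Σ m : Fin n, BoundedAnti k m) ≃ BoundedAnti (k + 1) n where
  toFun x := ⟨Fin.cons x.1.1 x.2.1, strictAnti_cons_iff.2 x.2.2, fun j => by
    cases j using Fin.cases with
    | zero => simp
    | succ j => simpa using (x.2.2.2 j).trans x.1.2⟩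
  invFun i := ⟨⟨i.1 0, i.2.2 0⟩, Fin.tail i.1,
    strictAnti_cons_iff.1 (by rw [Fin.cons_self_tail]; exact i.2.1)⟩
  left_inv _ := rfl
  right_inv i := by simp

theorem boundedAntiConsEquiv_coe {k n : ℕ} {m : Fin n} (i : BoundedAnti k m) :
    (boundedAntiConsEquiv k n ⟨m, i⟩ : Fin (k + 1) → ℕ) = Fin.cons m.1 i.1 := rfl

theorem hasSum_boundedAnti (p k n : ℕ) :
    HasSum (fun i : BoundedAnti k n => ∏ j, 1 / ((2 * i.1 j + p : ℕ) : ℝ) ^ 2)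
      (nestedSum p k n) := by
  induction k generalizing n with
  | zero =>
    have : Unique (BoundedAnti 0 n) :=
      ⟨⟨⟨Fin.elim0, fun a => a.elim0, fun a => a.elim0⟩⟩, fun a => Subtype.ext (Subsingleton.elim _ _)⟩
    simp [nestedSum]
  | succ k ih =>
    rw [← (boundedAntiConsEquiv k n).hasSum_iff]
    refine hasSum_sigma_of_nonneg (g := fun m : Fin n => nestedSum p k m / ((2 * m + p : ℕ) : ℝ) ^ 2)
      (fun x => ?_) (fun m => ?_) ?_
    · rw [Function.comp_apply]
      positivity
    · have h := (ih m).mul_left (1 / ((2 * m + p : ℕ) : ℝ) ^ 2)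
      rw [one_div_mul_eq_div] at h
      refine h.congr_fun fun i => ?_
      rw [Function.comp_apply, boundedAntiConsEquiv_coe]
      simp [Fin.prod_univ_succ, mul_comm]
    · rw [nestedSum, ← Fin.sum_univ_eq_sum_range
        (fun m => nestedSum p k m / ((2 * m + p : ℕ) : ℝ) ^ 2)]
      exact hasSum_fintype _

theorem hasSum_term_strictAnti {p N : ℕ} {S : ℝ}
    (hS : HasSum (fun i => nestedSum p N i / ((2 * i + p : ℕ) : ℝ) ^ 3) S) :
    HasSum (fun i : {i : Fin (N + 1) → ℕ // StrictAnti i} =>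
      term (index322 N) fun j => 2 * i.1 j + p) S := by
  rw [← (strictAntiConsEquiv N).hasSum_iff]
  refine hasSum_sigma_of_nonneg (fun x => ?_) (fun m => ?_) hS
  · simp only [Function.comp_apply, term]
    positivity
  · have h := (hasSum_boundedAnti p N m).mul_left (1 / ((2 * m + p : ℕ) : ℝ) ^ 3)
    rw [one_div_mul_eq_div] at h
    refine h.congr_fun fun i => ?_
    rw [Function.comp_apply, strictAntiConsEquiv_coe]
    simp [term, index322, Fin.prod_univ_succ, mul_comm]

/-- Strictly decreasing tuples of odd numbers are of the form `2 i + 1`. -/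
def decreasingOddEquiv (k : ℕ) : {i : Fin k → ℕ // StrictAnti i} ≃ DecreasingOdd k where
  toFun i := ⟨fun j => 2 * i.1 j + 1, fun a b hab => by have := i.2 hab; simp only; omega,
    fun j => ⟨Nat.le_add_left 1 _, ⟨_, rfl⟩⟩⟩
  invFun n := ⟨fun j => n.1 j / 2, fun a b hab => by
    have h1 := n.2.1 hab
    obtain ⟨c, hc⟩ := (n.2.2 a).2
    obtain ⟨d, hd⟩ := (n.2.2 b).2
    simp only
    omega⟩
  left_inv i := by
    ext j
    change (2 * i.1 j + 1) / 2 = i.1 j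
    omega
  right_inv n := by
    ext j
    obtain ⟨c, hc⟩ := (n.2.2 j).2
    simp only
    omega

/-- Strictly decreasing tuples of positive numbers are of the form `i + 1`. -/
def decreasingEquiv (k : ℕ) : {i : Fin k → ℕ // StrictAnti i} ≃ Decreasing k where
  toFun i := ⟨fun j => i.1 j + 1, fun a b hab => by have := i.2 hab; simp only; omega,
    fun j => Nat.le_add_left 1 _⟩
  invFun n := ⟨fun j => n.1 j - 1, fun a b hab => by
    have h1 := n.2.1 hab
    have := n.2.2 a
    have := n.2.2 b
    simp only
    omega⟩
  left_inv i := by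
    ext j
    change i.1 j + 1 - 1 = i.1 j
    omega
  right_inv n := by
    ext j
    have := n.2.2 j
    simp only
    omega

theorem term_two_mul {N : ℕ} (i : Fin (N + 1) → ℕ) :
    term (index322 N) i = 2 ^ (2 * N + 3) * term (index322 N) fun j => 2 * i j := by
  simp only [term, index322, Fin.prod_univ_succ, Fin.cons_zero, Fin.cons_succ, Nat.cast_mul,
    Nat.cast_ofNat, mul_pow, prod_mul_distrib, prod_const, card_univ, Fintype.card_fin]
  rw [show (2 : ℝ) ^ 3 * (2 ^ 2) ^ N = 2 ^ (2 * N + 3) by rw [pow_add, pow_mul, mul_comm],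
    one_div, one_div, mul_inv (2 ^ (2 * N + 3) : ℝ), mul_inv_cancel_left₀ (by positivity)]

theorem hasSum_mtv (N : ℕ) : ∃ S : ℝ, (S : ℂ) ∈ gradedPart N (2 * N + 3) ∧
    HasSum (fun n : DecreasingOdd (N + 1) => term (index322 N) n) S := by
  obtain ⟨S, hS, h⟩ := hasSum_nestedSum_one N
  refine ⟨S, hS, ?_⟩
  rw [← (decreasingOddEquiv (N + 1)).hasSum_iff]
  exact hasSum_term_strictAnti h

theorem hasSum_mzv (N : ℕ) : ∃ S : ℝ, (S : ℂ) ∈ gradedPart N (2 * N + 3) ∧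
    HasSum (fun n : Decreasing (N + 1) => term (index322 N) n) S := by
  obtain ⟨S, hS, h⟩ := hasSum_nestedSum_two N
  -- For p = 2 the entries are the even numbers 2(i + 1); halving all of them multiplies each term
  -- by 2^(2N+3).
  refine ⟨((2 ^ (2 * N + 3) : ℚ) : ℝ) * S, smul_mem_gradedPart _ hS, ?_⟩
  rw [← (decreasingEquiv (N + 1)).hasSum_iff]
  refine ((hasSum_term_strictAnti h).mul_left _).congr_fun fun i => ?_
  rw [Function.comp_apply, term_two_mul]
  push_cast
  rfl

end MultipleZeta

theorem corollary3p4 (N : ℕ) :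
    (Summable (fun n : MultipleZeta.Decreasing (N + 1) =>
        MultipleZeta.term (MultipleZeta.index322 N) n) ∧
      ((MultipleZeta.mzv (MultipleZeta.index322 N) : ℝ) : ℂ) ∈
        MultipleZeta.gradedPart N (2 * N + 3)) ∧
    (Summable (fun n : MultipleZeta.DecreasingOdd (N + 1) =>
        MultipleZeta.term (MultipleZeta.index322 N) n) ∧
      ((MultipleZeta.mtv (MultipleZeta.index322 N) : ℝ) : ℂ) ∈
        MultipleZeta.gradedPart N (2 * N + 3)) := by
  obtain ⟨S, hS, h⟩ := MultipleZeta.hasSum_mzv N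
  obtain ⟨T, hT, h'⟩ := MultipleZeta.hasSum_mtv N
  refine ⟨⟨h.summable, ?_⟩, h'.summable, ?_⟩
  · rwa [MultipleZeta.mzv, h.tsum_eq]
  · rwa [MultipleZeta.mtv, h'.tsum_eq]
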